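/- **Setting.** Let $\mathcal C$ be a bicategory (its associators are suppressed below; they are inserted in the only possible way) and let $W$ be a class of $1$-morphisms of $\mathcal C$ admitting a right bicalculus of fractions, i.e.: * (BF1) $W$ contains all identities; (BF2) $W$ is closed under composition; (BF5) if $w\in W$ and there is an invertible $v\Rightarrow w$, then $v\in W$; * (BF3) for $w:A\to B$ in $W$ and $f:C\to B$ there are $w':D\to C$ in $W$, $f':D\to A$ and an invertible $f\circ w'\Rightarrow w\circ f'$; * (BF4) for $w:B\to A$ in $W$, $f^1,f^2:C\to B$ and $\alpha:w\circ f^1\Rightarrow w\circ f^2$ there are $v:D\to C$ in $W$ and $\beta:f^1\circ v\Rightarrow f^2\circ v$ with $\alpha\circ v=w\circ\beta$, with $\beta$ invertible if $\alpha$ is; and for any two triples $(D,v,\beta)$, $(D',v',\beta')$ with $v,v'\in W$, $\alpha\circ v=w\circ\beta$ and $\alpha\circ v'=w\circ\beta'$ there are $s:E\to D$, $s':E\to D'$ and an invertible $\zeta:v\circ s\Rightarrow v'\circ s'$ such that $v\circ s\in W$ and $(\beta'\circ s')\cdot(f^1\circ\zeta)=(f^2\circ\zeta)\cdot(\beta\circ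 s)$. Fix choices $C(W)$: for each $f:A'\to B$ and each $v:B'\to B$ in $W$, data $(A'',v',f',\rho)$ with $v':A''\to A'$ in $W$, $f':A''\to B'$ and $\rho:f\circ v'\Rightarrow v\circ f'$ invertible. Choices $D(W)$ consist of a pair $(v,\beta)$ as in the first half of (BF4) for each $(w,f^1,f^2,\alpha)$ as there. A $1$-morphism $A\to B$ of $\mathcal C[W^{-1}]$ is a triple $(A',w,f)$ with $w:A'\to A$ in $W$ and $f:A'\to B$. The composite of $(A',w,f):A\to B$ and $(B',v,g):B\to C$ is $(A'',w\circ v',g\circ f')$, with $(A'',v',f',\rho)$ the choice in $C(W)$ for $(f,v)$. A $2$-morphism $(A^1,w^1,f^1)\Rightarrow(A^2,w^2,f^2)$ is an equivalence class of diagrams $(A^3,v^1,v^2,\alpha,\beta)$ with $v^m:A^3\to A^m$, $w^1\circ v^1\in W$, $\alpha:w^1\circ v^1\Rightarrow w^2\circ v^2$ invertible and $\beta:f^1\circ v^1\Rightarrow f^2\circ v^2$. Such a diagram is equivalent to $(A'^3,v'^1,v'^2,\alpha',\beta')$ if there are $z:E\to A^3$, $z':E\to A'^3$ and invertible $\sigma^1:v'^1\circ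 z'\Rightarrow v^1\circ z$, $\sigma^2:v^2\circ z\Rightarrow v'^2\circ z'$ such that $w^1\circ v^1\circ z\in W$, $\alpha'\circ z'=(w^2\circ\sigma^2)\cdot(\alpha\circ z)\cdot(w^1\circ\sigma^1)$ and $\beta'\circ z'=(f^2\circ\sigma^2)\cdot(\beta\circ z)\cdot(f^1\circ\sigma^1)$. **Data.** Let $\underline f=(A',u,f):A\to B$, $\underline g=(B',v,g):B\to C$, $\underline h=(C',w,h):C\to D$ be $1$-morphisms of $\mathcal C[W^{-1}]$. Let $C(W)$ choose, for the pairs $(f,v)$, $(g\circ f^1,w)$, $(g,w)$, $(f,v\circ v^1)$ respectively, $$\delta:f\circ u^1\Rightarrow v\circ f^1,\quad \sigma:g\circ f^1\circ u^2\Rightarrow w\circ l,\quad \xi:g\circ v^1\Rightarrow w\circ g^1,\quad \eta:f\circ u^3\Rightarrow v\circ v^1\circ f^2,$$ where $u^1,u^2,v^1,u^3\in W$ have sources $A^1,A^2,B^2,A^3$. Then $\underline h\circ(\underline g\circ\underline f)=(A^2,u\circ u^1\circ u^2,h\circ l)$ and $(\underline h\circ\underline g)\circ\underline f=(A^3,u\circ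 u^3,h\circ g^1\circ f^2)$. Consider data $(A^4,u^4,u^5,\gamma,\omega,\rho)$ such that * (F1) $u^4:A^4\to A^2$ with $u\circ u^1\circ u^2\circ u^4\in W$, $u^5:A^4\to A^3$, and $\gamma:u^1\circ u^2\circ u^4\Rightarrow u^3\circ u^5$ is invertible; * (F2) $\omega:f^1\circ u^2\circ u^4\Rightarrow v^1\circ f^2\circ u^5$ is invertible and $v\circ\omega=(\eta\circ u^5)\cdot(f\circ\gamma)\cdot(\delta^{-1}\circ u^2\circ u^4)$; * (F3) $\rho:l\circ u^4\Rightarrow g^1\circ f^2\circ u^5$ is invertible and $w\circ\rho=(\xi\circ f^2\circ u^5)\cdot(g\circ\omega)\cdot(\sigma^{-1}\circ u^4)$. The associator $\Theta_{\underline h,\underline g,\underline f}:\underline h\circ(\underline g\circ\underline f)\Rightarrow(\underline h\circ\underline g)\circ\underline f$ defined by the choices $C(W)$ and $D(W)$ is the class of $(A^4,u^4,u^5,u\circ\gamma,h\circ\rho)$ for the following data (F1)–(F3): take the choice in $C(W)$ for $(u^1\circ u^2,u^3)$ as first version of $(\gamma,u^4,u^5)$; apply $D(W)$ to $v$ and the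 right-hand side of (F2) to get $\omega$ after restriction along a morphism of $W$; then apply $D(W)$ to $w$ and the right-hand side of (F3) to get $\rho$ after a further restriction along a morphism of $W$. **Proposition.** 1. For all choices $D(W)$ and *any* data satisfying (F1)–(F3), the associator $\Theta_{\underline h,\underline g,\underline f}$ is represented by the diagram $(A^4,u^4,u^5,u\circ\gamma,h\circ\rho)$. 2. Any two sets of data satisfying (F1)–(F3) induce equivalent diagrams $(A^4,u^4,u^5,u\circ\gamma,h\circ\rho)$. 3. Hence $\Theta_{\underline h,\underline g,\underline f}$ does not depend on $D(W)$, nor on any choice in $C(W)$ other than the four giving $\delta,\sigma,\xi,\eta$. -/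

import Mathlib

open CategoryTheory Bicategory

universe w v u

namespace BicatFractions

/-! Mathlib composes in diagrammatic order: `f ≫ g` is `g ∘ f`, `f ◁ α` is `α ∘ f` and `α ▷ g` is
`g ∘ α`.  The operation `⊗≫` is vertical composition of 2-morphisms with the associators of the
ambient bicategory inserted where they are needed. -/

section Axioms

variable {B : Type u} [Bicategory.{w, v} B]

/-- A square filling the cospan `a --f--> b <--v-- b'`: a span `a <--fst-- obj --snd--> b'` with
`fst` in `W` and an invertible 2-morphism `f ∘ fst ⇒ v ∘ snd`. -/
structure Filler (W : MorphismProperty B) {a b b' : B} (f : a ⟶ b) (v : b' ⟶ b) where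
  obj : B
  fst : obj ⟶ a
  snd : obj ⟶ b'
  mem : W fst
  iso : fst ≫ f ≅ snd ≫ v

/-- For `α : w ∘ f ⇒ w ∘ g`, a morphism `arr` in `W` and a 2-morphism `cell : f ∘ arr ⇒ g ∘ arr`
with `w ∘ cell = α ∘ arr`. -/
structure Lift (W : MorphismProperty B) {a b c : B} (w : b ⟶ a) (f g : c ⟶ b)
    (α : f ≫ w ⟶ g ≫ w) where
  obj : B
  arr : obj ⟶ c
  mem : W arr
  cell : arr ≫ f ⟶ arr ≫ g
  comm : cell ▷ w = 𝟙 _ ⊗≫ arr ◁ α ⊗≫ 𝟙 _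

/-- The class `W` admits a right bicalculus of fractions. -/
structure IsBicalculus (W : MorphismProperty B) : Prop where
  id_mem : ∀ a : B, W (𝟙 a)
  comp_mem : ∀ {a b c : B} (f : a ⟶ b) (g : b ⟶ c), W f → W g → W (f ≫ g)
  filler : ∀ {a b b' : B} (f : a ⟶ b) (v : b' ⟶ b), W v → Nonempty (Filler W f v)
  /-- Lifts along `W` exist, and can be taken invertible for invertible 2-morphisms. -/
  lift : ∀ {a b c : B} (w : b ⟶ a) (f g : c ⟶ b) (α : f ≫ w ⟶ g ≫ w), W w →
    ∃ L : Lift W w f g α, IsIso α → IsIso L.cell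
  /-- Any two lifts agree after restriction. -/
  lift_unique : ∀ {a b c : B} (w : b ⟶ a) (f g : c ⟶ b) (α : f ≫ w ⟶ g ≫ w), W w →
    ∀ L L' : Lift W w f g α,
      ∃ (e : B) (s : e ⟶ L.obj) (s' : e ⟶ L'.obj) (ζ : s ≫ L.arr ≅ s' ≫ L'.arr),
        W (s ≫ L.arr) ∧
          ζ.hom ▷ f ⊗≫ s' ◁ L'.cell ⊗≫ 𝟙 ((s' ≫ L'.arr) ≫ g) =
            𝟙 ((s ≫ L.arr) ≫ f) ⊗≫ s ◁ L.cell ⊗≫ ζ.hom ▷ g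
  of_iso : ∀ {a b : B} (f g : a ⟶ b), W f → Nonempty (g ≅ f) → W g

/-- The choices `C(W)`: a square for every cospan whose second leg is in `W`. -/
abbrev ChoiceC (W : MorphismProperty B) :=
  ∀ ⦃a b b' : B⦄ (f : a ⟶ b) (v : b' ⟶ b), W v → Filler W f v

/-- The choices `D(W)`: a lift, invertible whenever `α` is, of every
`α : w ∘ f ⇒ w ∘ g` with `w` in `W`. -/
abbrev ChoiceD (W : MorphismProperty B) :=
  ∀ ⦃a b c : B⦄ (w : b ⟶ a) (f g : c ⟶ b) (α : f ≫ w ⟶ g ≫ w), W w →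
    {L : Lift W w f g α // IsIso α → IsIso L.cell}

end Axioms

section Fractions

variable {B : Type u} [Bicategory.{w, v} B] {W : MorphismProperty B}

/-- The 1-morphisms `a ⟶ b` of `C[W⁻¹]`: triples `(apex, den, num)` with `den : apex ⟶ a` in `W`
and `num : apex ⟶ b`. -/
structure Fraction (W : MorphismProperty B) (a b : B) where
  apex : B
  den : apex ⟶ a
  num : apex ⟶ b
  mem : W den

/-- The composite `G ∘ F` formed with a given square. -/
abbrev Fraction.compAlong (hW : IsBicalculus W) {a b c : B} (F : Fraction W a b)
    (G : Fraction W b c) (s : Filler W F.num G.den) : Fraction W a c where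
  apex := s.obj
  den := s.fst ≫ F.den
  num := s.snd ≫ G.num
  mem := hW.comp_mem _ _ s.mem F.mem

/-- The composite `G ∘ F` in `C[W⁻¹]`, formed with the square chosen by `C(W)`. -/
abbrev Fraction.comp (hW : IsBicalculus W) (C : ChoiceC W) {a b c : B} (F : Fraction W a b)
    (G : Fraction W b c) : Fraction W a c :=
  F.compAlong hW G (C F.num G.den G.mem)

/-- The data `(apex, left, right, α, β)` that represent 2-morphisms `F ⟹ F'` of `C[W⁻¹]`. -/
structure Diagram {a b : B} (F F' : Fraction W a b) where
  apex : B
  left : apex ⟶ F.apex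
  right : apex ⟶ F'.apex
  mem : W (left ≫ F.den)
  α : left ≫ F.den ≅ right ≫ F'.den
  β : left ≫ F.num ⟶ right ≫ F'.num

/-- Equivalence of diagrams. -/
def Diagram.Equivalent {a b : B} {F F' : Fraction W a b} (X Y : Diagram F F') : Prop :=
  ∃ (e : B) (z : e ⟶ X.apex) (z' : e ⟶ Y.apex)
    (σ₁ : z' ≫ Y.left ≅ z ≫ X.left) (σ₂ : z ≫ X.right ≅ z' ≫ Y.right),
    W (z ≫ X.left ≫ F.den) ∧
      𝟙 (z' ≫ Y.left ≫ F.den) ⊗≫ σ₁.hom ▷ F.den ⊗≫ z ◁ X.α.hom ⊗≫ σ₂.hom ▷ F'.den ⊗≫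
          𝟙 (z' ≫ Y.right ≫ F'.den) = z' ◁ Y.α.hom ∧
      𝟙 (z' ≫ Y.left ≫ F.num) ⊗≫ σ₁.hom ▷ F.num ⊗≫ z ◁ X.β ⊗≫ σ₂.hom ▷ F'.num ⊗≫
          𝟙 (z' ≫ Y.right ≫ F'.num) = z' ◁ Y.β

/-- The 2-morphisms `F ⟹ F'` of `C[W⁻¹]`: diagrams modulo equivalence. -/
def TwoMorphism {a b : B} (F F' : Fraction W a b) :=
  Quot (Diagram.Equivalent (F := F) (F' := F'))

/-- The 2-morphism represented by a diagram. -/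
def Diagram.toTwoMorphism {a b : B} {F F' : Fraction W a b} (X : Diagram F F') :
    TwoMorphism F F' :=
  Quot.mk _ X

end Fractions

section Associators

variable {B : Type u} [Bicategory.{w, v} B] {W : MorphismProperty B} {a b c d : B}

/-- The four squares `δ, σ, ξ, η` used to form `h ∘ (g ∘ f)` and `(h ∘ g) ∘ f`. -/
structure Squares (F : Fraction W a b) (G : Fraction W b c) (H : Fraction W c d) where
  δ : Filler W F.num G.den
  σ : Filler W (δ.snd ≫ G.num) H.den
  ξ : Filler W G.num H.den
  η : Filler W F.num (ξ.fst ≫ G.den)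

/-- The four squares provided by the choices `C(W)`. -/
abbrev Squares.ofChoice (hW : IsBicalculus W) (C : ChoiceC W) (F : Fraction W a b)
    (G : Fraction W b c) (H : Fraction W c d) : Squares F G H where
  δ := C F.num G.den G.mem
  σ := C (F.comp hW C G).num H.den H.mem
  ξ := C G.num H.den H.mem
  η := C F.num (G.comp hW C H).den (G.comp hW C H).mem

namespace Squares

variable {F : Fraction W a b} {G : Fraction W b c} {H : Fraction W c d}

/-- `h ∘ (g ∘ f)`. -/
abbrev source (hW : IsBicalculus W) (S : Squares F G H) : Fraction W a d :=
  (F.compAlong hW G S.δ).compAlong hW H S.σ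

/-- `(h ∘ g) ∘ f`. -/
abbrev target (hW : IsBicalculus W) (S : Squares F G H) : Fraction W a d :=
  F.compAlong hW (G.compAlong hW H S.ξ) S.η

/-- The pasting of `δ⁻¹`, `γ` and `η`; the 2-morphism `v ∘ ω` has to be equal to it. -/
def omegaPasting (S : Squares F G H) {x : B} (u₄ : x ⟶ S.σ.obj) (u₅ : x ⟶ S.η.obj)
    (γ : u₄ ≫ S.σ.fst ≫ S.δ.fst ≅ u₅ ≫ S.η.fst) :
    (u₄ ≫ S.σ.fst ≫ S.δ.snd) ≫ G.den ⟶ (u₅ ≫ S.η.snd ≫ S.ξ.fst) ≫ G.den :=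
  𝟙 _ ⊗≫ u₄ ◁ S.σ.fst ◁ S.δ.iso.inv ⊗≫ γ.hom ▷ F.num ⊗≫ u₅ ◁ S.η.iso.hom ⊗≫ 𝟙 _

/-- The pasting of `σ⁻¹`, `ω` and `ξ`; the 2-morphism `w ∘ ρ` has to be equal to it. -/
def rhoPasting (S : Squares F G H) {x : B} (u₄ : x ⟶ S.σ.obj) (u₅ : x ⟶ S.η.obj)
    (ω : u₄ ≫ S.σ.fst ≫ S.δ.snd ≅ u₅ ≫ S.η.snd ≫ S.ξ.fst) :
    (u₄ ≫ S.σ.snd) ≫ H.den ⟶ (u₅ ≫ S.η.snd ≫ S.ξ.snd) ≫ H.den :=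
  𝟙 _ ⊗≫ u₄ ◁ S.σ.iso.inv ⊗≫ ω.hom ▷ G.num ⊗≫ u₅ ◁ S.η.snd ◁ S.ξ.iso.hom ⊗≫ 𝟙 _

/-- The data `(A⁴, u⁴, u⁵, γ, ω, ρ)` from which the associator is computed. -/
structure AssociatorData (S : Squares F G H) where
  apex : B
  u₄ : apex ⟶ S.σ.obj
  u₅ : apex ⟶ S.η.obj
  mem : W (u₄ ≫ S.σ.fst ≫ S.δ.fst ≫ F.den)
  γ : u₄ ≫ S.σ.fst ≫ S.δ.fst ≅ u₅ ≫ S.η.fst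
  ω : u₄ ≫ S.σ.fst ≫ S.δ.snd ≅ u₅ ≫ S.η.snd ≫ S.ξ.fst
  ω_comm : ω.hom ▷ G.den = S.omegaPasting u₄ u₅ γ
  ρ : u₄ ≫ S.σ.snd ≅ u₅ ≫ S.η.snd ≫ S.ξ.snd
  ρ_comm : ρ.hom ▷ H.den = S.rhoPasting u₄ u₅ ω

/-- The diagram `(A⁴, u⁴, u⁵, u ∘ γ, h ∘ ρ)`. -/
def AssociatorData.diagram (hW : IsBicalculus W) {S : Squares F G H} (X : S.AssociatorData) :
    Diagram (S.source hW) (S.target hW) where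
  apex := X.apex
  left := X.u₄
  right := X.u₅
  mem := X.mem
  α := Iso.refl (X.u₄ ≫ S.σ.fst ≫ S.δ.fst ≫ F.den) ≪⊗≫ whiskerRightIso X.γ F.den ≪⊗≫
    Iso.refl (X.u₅ ≫ S.η.fst ≫ F.den)
  β := 𝟙 (X.u₄ ≫ S.σ.snd ≫ H.num) ⊗≫ X.ρ.hom ▷ H.num ⊗≫
    𝟙 (X.u₅ ≫ S.η.snd ≫ S.ξ.snd ≫ H.num)

theorem isIso_omegaPasting (S : Squares F G H) {x : B} (u₄ : x ⟶ S.σ.obj) (u₅ : x ⟶ S.η.obj)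
    (γ : u₄ ≫ S.σ.fst ≫ S.δ.fst ≅ u₅ ≫ S.η.fst) : IsIso (S.omegaPasting u₄ u₅ γ) := by
  unfold omegaPasting bicategoricalComp
  infer_instance

theorem isIso_rhoPasting (S : Squares F G H) {x : B} (u₄ : x ⟶ S.σ.obj) (u₅ : x ⟶ S.η.obj)
    (ω : u₄ ≫ S.σ.fst ≫ S.δ.snd ≅ u₅ ≫ S.η.snd ≫ S.ξ.fst) : IsIso (S.rhoPasting u₄ u₅ ω) := by
  unfold rhoPasting bicategoricalComp
  infer_instance

theorem omegaPasting_whisker (S : Squares F G H) {x y : B} (r : y ⟶ x) (u₄ : x ⟶ S.σ.obj)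
    (u₅ : x ⟶ S.η.obj) (γ : u₄ ≫ S.σ.fst ≫ S.δ.fst ≅ u₅ ≫ S.η.fst) :
    S.omegaPasting (r ≫ u₄) (r ≫ u₅) (α_ _ _ _ ≪≫ whiskerLeftIso r γ ≪≫ (α_ _ _ _).symm) =
      𝟙 _ ⊗≫ r ◁ S.omegaPasting u₄ u₅ γ ⊗≫ 𝟙 _ := by
  simp only [omegaPasting, Iso.trans_hom, whiskerLeftIso_hom, Iso.symm_hom]
  bicategory

theorem rhoPasting_whisker (S : Squares F G H) {x y : B} (r : y ⟶ x) (u₄ : x ⟶ S.σ.obj)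
    (u₅ : x ⟶ S.η.obj) (ω : u₄ ≫ S.σ.fst ≫ S.δ.snd ≅ u₅ ≫ S.η.snd ≫ S.ξ.fst) :
    S.rhoPasting (r ≫ u₄) (r ≫ u₅) (α_ _ _ _ ≪≫ whiskerLeftIso r ω ≪≫ (α_ _ _ _).symm) =
      𝟙 _ ⊗≫ r ◁ S.rhoPasting u₄ u₅ ω ⊗≫ 𝟙 _ := by
  simp only [rhoPasting, Iso.trans_hom, whiskerLeftIso_hom, Iso.symm_hom]
  bicategory

theorem omega_comm_of_lift (S : Squares F G H) {x : B} (u₄ : x ⟶ S.σ.obj) (u₅ : x ⟶ S.η.obj)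
    (γ : u₄ ≫ S.σ.fst ≫ S.δ.fst ≅ u₅ ≫ S.η.fst)
    (L : Lift W G.den _ _ (S.omegaPasting u₄ u₅ γ)) :
    ((α_ _ _ _).hom ≫ L.cell ≫ (α_ _ _ _).inv) ▷ G.den =
      S.omegaPasting (L.arr ≫ u₄) (L.arr ≫ u₅)
        (α_ _ _ _ ≪≫ whiskerLeftIso L.arr γ ≪≫ (α_ _ _ _).symm) := by
  rw [omegaPasting_whisker, comp_whiskerRight, comp_whiskerRight, L.comm]
  bicategory

theorem omega_comm_whisker (S : Squares F G H) {x y : B} (r : y ⟶ x) (u₄ : x ⟶ S.σ.obj)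
    (u₅ : x ⟶ S.η.obj) (γ : u₄ ≫ S.σ.fst ≫ S.δ.fst ≅ u₅ ≫ S.η.fst)
    (ω : u₄ ≫ S.σ.fst ≫ S.δ.snd ≅ u₅ ≫ S.η.snd ≫ S.ξ.fst)
    (h : ω.hom ▷ G.den = S.omegaPasting u₄ u₅ γ) :
    ((α_ _ _ _).hom ≫ r ◁ ω.hom ≫ (α_ _ _ _).inv) ▷ G.den =
      S.omegaPasting (r ≫ u₄) (r ≫ u₅)
        (α_ _ _ _ ≪≫ whiskerLeftIso r γ ≪≫ (α_ _ _ _).symm) := by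
  rw [omegaPasting_whisker, ← h]
  bicategory

theorem rho_comm_of_lift (S : Squares F G H) {x : B} (u₄ : x ⟶ S.σ.obj) (u₅ : x ⟶ S.η.obj)
    (ω : u₄ ≫ S.σ.fst ≫ S.δ.snd ≅ u₅ ≫ S.η.snd ≫ S.ξ.fst)
    (M : Lift W H.den _ _ (S.rhoPasting u₄ u₅ ω)) :
    ((α_ _ _ _).hom ≫ M.cell ≫ (α_ _ _ _).inv) ▷ H.den =
      S.rhoPasting (M.arr ≫ u₄) (M.arr ≫ u₅)
        (α_ _ _ _ ≪≫ whiskerLeftIso M.arr ω ≪≫ (α_ _ _ _).symm) := by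
  rw [rhoPasting_whisker, comp_whiskerRight, comp_whiskerRight, M.comm]
  bicategory

/-- The associator data obtained from a square `s` over `A'` for the cospan formed by `u¹ ∘ u²`
and `u³`, a lift `L` along `v` of the resulting pasting of `δ⁻¹`, `s.iso` and `η`, and a lift `M`
along `w` of the resulting pasting of `σ⁻¹`, `ω` and `ξ`; all data are restricted to `M.obj`. -/
noncomputable def dataOfLifts (hW : IsBicalculus W) (S : Squares F G H)
    (s : Filler W (S.σ.fst ≫ S.δ.fst) S.η.fst)
    (L : Lift W G.den _ _ (S.omegaPasting s.fst s.snd s.iso)) [IsIso L.cell]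
    (M : Lift W H.den _ _ (S.rhoPasting (L.arr ≫ s.fst) (L.arr ≫ s.snd)
      (α_ _ _ _ ≪≫ asIso L.cell ≪≫ (α_ _ _ _).symm))) [IsIso M.cell] :
    S.AssociatorData where
  apex := M.obj
  u₄ := M.arr ≫ L.arr ≫ s.fst
  u₅ := M.arr ≫ L.arr ≫ s.snd
  mem := hW.comp_mem _ _
    (hW.comp_mem _ _ M.mem (hW.comp_mem _ _ L.mem s.mem))
    (hW.comp_mem _ _ S.σ.mem (hW.comp_mem _ _ S.δ.mem F.mem))
  γ := α_ _ _ _ ≪≫ whiskerLeftIso M.arr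
    (α_ _ _ _ ≪≫ whiskerLeftIso L.arr s.iso ≪≫ (α_ _ _ _).symm) ≪≫ (α_ _ _ _).symm
  ω := α_ _ _ _ ≪≫ whiskerLeftIso M.arr
    (α_ _ _ _ ≪≫ asIso L.cell ≪≫ (α_ _ _ _).symm) ≪≫ (α_ _ _ _).symm
  ω_comm := S.omega_comm_whisker M.arr _ _ _ _ (S.omega_comm_of_lift _ _ _ L)
  ρ := α_ _ _ _ ≪≫ asIso M.cell ≪≫ (α_ _ _ _).symm
  ρ_comm := S.rho_comm_of_lift _ _ _ M

/-- The associator data induced by the choices: the square over `A'` is the one in `C(W)`, the two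
lifts are those in `D(W)`. -/
noncomputable def chosenData (hW : IsBicalculus W) (C : ChoiceC W) (D : ChoiceD W)
    (S : Squares F G H) : S.AssociatorData :=
  let s := C (S.σ.fst ≫ S.δ.fst) S.η.fst S.η.mem
  let L := D G.den _ _ (S.omegaPasting s.fst s.snd s.iso) G.mem
  haveI : IsIso L.1.cell := L.2 (S.isIso_omegaPasting _ _ _)
  let M := D H.den _ _ (S.rhoPasting (L.1.arr ≫ s.fst) (L.1.arr ≫ s.snd)
    (α_ _ _ _ ≪≫ asIso L.1.cell ≪≫ (α_ _ _ _).symm)) H.mem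
  haveI : IsIso M.1.cell := M.2 (S.isIso_rhoPasting _ _ _)
  S.dataOfLifts hW s L.1 M.1

/-- The 2-morphism `h ∘ (g ∘ f) ⟹ (h ∘ g) ∘ f` obtained from the choices `C(W)` and `D(W)`, where
the composites are formed with the given squares. -/
noncomputable def associator (hW : IsBicalculus W) (C : ChoiceC W) (D : ChoiceD W)
    (S : Squares F G H) : TwoMorphism (S.source hW) (S.target hW) :=
  ((S.chosenData hW C D).diagram hW).toTwoMorphism

end Squares

/-- The associator of `C[W⁻¹]`, constructed from the choices `C(W)` and `D(W)`. -/
noncomputable def associator (hW : IsBicalculus W) (C : ChoiceC W) (D : ChoiceD W)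
    (F : Fraction W a b) (G : Fraction W b c) (H : Fraction W c d) :
    TwoMorphism ((F.comp hW C G).comp hW C H) (F.comp hW C (G.comp hW C H)) :=
  (Squares.ofChoice hW C F G H).associator hW C D

end Associators

end BicatFractions

/-! Everything that is built from `γ` by pasting with fixed 2-morphisms commutes with restriction
along a common refinement of `A⁴` and `A'⁴`.  A refinement on which the two copies of `γ` agree
exists by (BF3) and (BF4).  There the pastings `v ∘ ω` and `v ∘ ω'` agree by (F2), and since
whiskering with `v ∈ W` is faithful up to restriction along `W`, so do `ω` and `ω'` after one more
restriction.  In the same way (F3) passes from `ω` to `ρ`, and the diagrams are pastings of `γ` and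
of `ρ`. -/

namespace BicatFractions

section Cells

variable {B : Type u} [Bicategory.{w, v} B]

/-- The restriction of `κ : p ∘ l ⇒ q ∘ r` along `z`, bracketed as a 2-morphism
`p ∘ (l ∘ z) ⇒ q ∘ (r ∘ z)` of the same form. -/
def restrictCell {e s x y c : B} (z : e ⟶ s) {l : s ⟶ x} {r : s ⟶ y} {p : x ⟶ c} {q : y ⟶ c}
    (κ : l ≫ p ⟶ r ≫ q) : (z ≫ l) ≫ p ⟶ (z ≫ r) ≫ q :=
  (α_ z l p).hom ≫ z ◁ κ ≫ (α_ z r q).inv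

/-- The restriction of an invertible 2-morphism; its underlying 2-morphism is `restrictCell`. -/
@[simps]
def restrictIso {e s x y c : B} (z : e ⟶ s) {l : s ⟶ x} {r : s ⟶ y} {p : x ⟶ c} {q : y ⟶ c}
    (κ : l ≫ p ≅ r ≫ q) : (z ≫ l) ≫ p ≅ (z ≫ r) ≫ q where
  hom := restrictCell z κ.hom
  inv := restrictCell z κ.inv
  hom_inv_id := by simp [restrictCell]
  inv_hom_id := by simp [restrictCell]

/-- The pasting of `κ : p ∘ l ⇒ q ∘ r` with a 2-morphism `φ` out of `p₂` and a 2-morphism `ψ` into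
`q₂`. For `φ = 𝟙` and `ψ = 𝟙` it is the whiskering `f ∘ κ`. -/
def paste {s x y c d : B} {l : s ⟶ x} {r : s ⟶ y} {p : x ⟶ c} {q : y ⟶ c} {f : c ⟶ d}
    {p₂ : x ⟶ d} {q₂ : y ⟶ d} (φ : p₂ ⟶ p ≫ f) (ψ : q ≫ f ⟶ q₂) (κ : l ≫ p ⟶ r ≫ q) :
    l ≫ p₂ ⟶ r ≫ q₂ :=
  l ◁ φ ≫ (α_ l p f).inv ≫ κ ▷ f ≫ (α_ r q f).hom ≫ r ◁ ψ

theorem restrictCell_comp {e' e s x y c : B} (k : e' ⟶ e) (z : e ⟶ s) {l : s ⟶ x} {r : s ⟶ y}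
    {p : x ⟶ c} {q : y ⟶ c} (κ : l ≫ p ⟶ r ≫ q) :
    restrictCell (k ≫ z) κ =
      (α_ k z l).hom ▷ p ≫ restrictCell k (restrictCell z κ) ≫ (α_ k z r).inv ▷ q := by
  simp only [restrictCell]
  bicategory

theorem restrictCell_paste {e s x y c d : B} (z : e ⟶ s) {l : s ⟶ x} {r : s ⟶ y} {p : x ⟶ c}
    {q : y ⟶ c} {f : c ⟶ d} {p₂ : x ⟶ d} {q₂ : y ⟶ d} (φ : p₂ ⟶ p ≫ f) (ψ : q ≫ f ⟶ q₂)
    (κ : l ≫ p ⟶ r ≫ q) :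
    restrictCell z (paste φ ψ κ) = paste φ ψ (restrictCell z κ) := by
  simp only [restrictCell, paste]
  bicategory

theorem whiskerRight_comp_paste_comp_whiskerRight {s x y c d : B} {l l' : s ⟶ x} {r r' : s ⟶ y}
    {p : x ⟶ c} {q : y ⟶ c} {f : c ⟶ d} {p₂ : x ⟶ d} {q₂ : y ⟶ d} (φ : p₂ ⟶ p ≫ f)
    (ψ : q ≫ f ⟶ q₂) (κ : l ≫ p ⟶ r ≫ q) (σ : l' ⟶ l) (τ : r ⟶ r') :
    σ ▷ p₂ ≫ paste φ ψ κ ≫ τ ▷ q₂ = paste φ ψ (σ ▷ p ≫ κ ≫ τ ▷ q) := by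
  simp only [paste, comp_whiskerRight, Category.assoc, whisker_exchange τ ψ,
    ← whisker_exchange_assoc σ φ]
  bicategory

end Cells

section Refinements

variable {B : Type u} [Bicategory.{w, v} B] {s t x y c : B}

/-- A span `s <--fst-- obj --snd--> t` on which the spans `x <--l-- s --r--> y` and
`x <--l'-- t --r'--> y` are identified. The directions of the two invertible 2-morphisms are those
in the equivalence of diagrams. -/
structure CommonRefinement (l : s ⟶ x) (r : s ⟶ y) (l' : t ⟶ x) (r' : t ⟶ y) where
  obj : B
  fst : obj ⟶ s
  snd : obj ⟶ t
  isoLeft : snd ≫ l' ≅ fst ≫ l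
  isoRight : fst ≫ r ≅ snd ≫ r'

namespace CommonRefinement

variable {l : s ⟶ x} {r : s ⟶ y} {l' : t ⟶ x} {r' : t ⟶ y} {p : x ⟶ c} {q : y ⟶ c}

/-- The restriction of a common refinement along a morphism into its apex. -/
def restrict (P : CommonRefinement l r l' r') {e : B} (k : e ⟶ P.obj) :
    CommonRefinement l r l' r' where
  obj := e
  fst := k ≫ P.fst
  snd := k ≫ P.snd
  isoLeft := restrictIso k P.isoLeft
  isoRight := restrictIso k P.isoRight

/-- The restriction of `κ` along `P.fst`, carried over to the second span. -/
def transport (P : CommonRefinement l r l' r') (κ : l ≫ p ⟶ r ≫ q) :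
    (P.snd ≫ l') ≫ p ⟶ (P.snd ≫ r') ≫ q :=
  P.isoLeft.hom ▷ p ≫ restrictCell P.fst κ ≫ P.isoRight.hom ▷ q

/-- The restrictions of `κ` and `κ'` to the apex of `P` agree under the identifications of `P`. -/
def Matches (P : CommonRefinement l r l' r') (κ : l ≫ p ⟶ r ≫ q) (κ' : l' ≫ p ⟶ r' ≫ q) : Prop :=
  P.transport κ = restrictCell P.snd κ'

theorem transport_paste (P : CommonRefinement l r l' r') {d : B} {f : c ⟶ d} {p₂ : x ⟶ d}
    {q₂ : y ⟶ d} (φ : p₂ ⟶ p ≫ f) (ψ : q ≫ f ⟶ q₂) (κ : l ≫ p ⟶ r ≫ q) :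
    P.transport (paste φ ψ κ) = paste φ ψ (P.transport κ) := by
  simp only [transport, restrictCell_paste, whiskerRight_comp_paste_comp_whiskerRight]

theorem transport_restrict (P : CommonRefinement l r l' r') {e : B} (k : e ⟶ P.obj)
    (κ : l ≫ p ⟶ r ≫ q) :
    (P.restrict k).transport κ =
      (α_ k P.snd l').hom ▷ p ≫ restrictCell k (P.transport κ) ≫ (α_ k P.snd r').inv ▷ q := by
  simp only [transport, restrict, restrictIso_hom, restrictCell]
  bicategory

theorem matches_restrict (P : CommonRefinement l r l' r') {e : B} (k : e ⟶ P.obj)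
    {κ : l ≫ p ⟶ r ≫ q} {κ' : l' ≫ p ⟶ r' ≫ q}
    (h : k ◁ P.transport κ = k ◁ restrictCell P.snd κ') : (P.restrict k).Matches κ κ' := by
  rw [Matches, transport_restrict, restrictCell, h]
  exact (restrictCell_comp k P.snd κ').symm

namespace Matches

variable {P : CommonRefinement l r l' r'} {κ : l ≫ p ⟶ r ≫ q} {κ' : l' ≫ p ⟶ r' ≫ q}

theorem restrict (h : P.Matches κ κ') {e : B} (k : e ⟶ P.obj) : (P.restrict k).Matches κ κ' :=
  P.matches_restrict k (congrArg (k ◁ ·) h)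

theorem paste (h : P.Matches κ κ') {d : B} {f : c ⟶ d} {p₂ : x ⟶ d} {q₂ : y ⟶ d}
    (φ : p₂ ⟶ p ≫ f) (ψ : q ≫ f ⟶ q₂) : P.Matches (paste φ ψ κ) (paste φ ψ κ') := by
  rw [Matches, transport_paste, h, restrictCell_paste]

end Matches

end CommonRefinement

theorem Diagram.equivalent_of_matches {W : MorphismProperty B} {a b : B} {F F' : Fraction W a b}
    {X Y : Diagram F F'} (P : CommonRefinement X.left X.right Y.left Y.right)
    (hP : W (P.fst ≫ X.left ≫ F.den)) (hα : P.Matches X.α.hom Y.α.hom)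
    (hβ : P.Matches X.β Y.β) : X.Equivalent Y := by
  have key {c : B} {p : F.apex ⟶ c} {q : F'.apex ⟶ c} {κ : X.left ≫ p ⟶ X.right ≫ q}
      {κ' : Y.left ≫ p ⟶ Y.right ≫ q} (h : P.Matches κ κ') :
      𝟙 (P.snd ≫ Y.left ≫ p) ⊗≫ P.isoLeft.hom ▷ p ⊗≫ P.fst ◁ κ ⊗≫ P.isoRight.hom ▷ q ⊗≫
        𝟙 (P.snd ≫ Y.right ≫ q) = P.snd ◁ κ' :=
    calc
      _ = (α_ _ _ _).inv ≫ P.transport κ ≫ (α_ _ _ _).hom := by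
        simp only [CommonRefinement.transport, restrictCell]
        bicategory
      _ = P.snd ◁ κ' := by
        simp only [show P.transport κ = _ from h, restrictCell, Category.assoc,
          Iso.inv_hom_id, Iso.inv_hom_id_assoc, Category.comp_id]
  exact ⟨P.obj, P.fst, P.snd, P.isoLeft, P.isoRight, hP, key hα, key hβ⟩

end Refinements

namespace IsBicalculus

variable {B : Type u} [Bicategory.{w, v} B] {W : MorphismProperty B}

/- `𝟙 ◁ β` and `𝟙 ◁ β'` are two lifts of the same 2-morphism; the comparison of (BF4) between them
relates the restrictions of `β` and `β'` by conjugation with `ζ`, which the interchange law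
cancels. -/
theorem exists_whiskerLeft_eq (hW : IsBicalculus W) {a b c : B} {w : b ⟶ a} (hw : W w)
    {f g : c ⟶ b} {β β' : f ⟶ g} (h : β ▷ w = β' ▷ w) :
    ∃ (e : B) (r : e ⟶ c), W r ∧ r ◁ β = r ◁ β' := by
  obtain ⟨e, s, s', ζ, hs, hζ⟩ := hW.lift_unique w f g (β ▷ w) hw
    ⟨c, 𝟙 c, hW.id_mem c, 𝟙 c ◁ β, by bicategory⟩
    ⟨c, 𝟙 c, hW.id_mem c, 𝟙 c ◁ β', by rw [h]; bicategory⟩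
  dsimp only at ζ hs hζ
  refine ⟨e, s ≫ 𝟙 c, hs, ?_⟩
  rw [← cancel_mono (ζ.hom ▷ g), whisker_exchange _ β']
  calc (s ≫ 𝟙 c) ◁ β ≫ ζ.hom ▷ g
      = 𝟙 ((s ≫ 𝟙 c) ≫ f) ⊗≫ s ◁ 𝟙 c ◁ β ⊗≫ ζ.hom ▷ g := by bicategory
    _ = ζ.hom ▷ f ⊗≫ s' ◁ 𝟙 c ◁ β' ⊗≫ 𝟙 ((s' ≫ 𝟙 c) ≫ g) := hζ.symm
    _ = ζ.hom ▷ f ≫ (s' ≫ 𝟙 c) ◁ β' := by bicategory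

theorem exists_iso_lift (hW : IsBicalculus W) {a b c : B} {w : b ⟶ a} (hw : W w) {f g : c ⟶ b}
    (α : f ≫ w ≅ g ≫ w) :
    ∃ (e : B) (r : e ⟶ c) (β : r ≫ f ≅ r ≫ g), W r ∧ β.hom ▷ w = restrictCell r α.hom := by
  obtain ⟨L, hL⟩ := hW.lift w f g α.hom hw
  have : IsIso L.cell := hL inferInstance
  refine ⟨L.obj, L.arr, asIso L.cell, L.mem, L.comm.trans ?_⟩
  rw [restrictCell]
  bicategory

theorem nonempty_filler_of_comp_mem (hW : IsBicalculus W) {a b b' c : B} (f : a ⟶ b)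
    {v : b' ⟶ b} {w : b ⟶ c} (hw : W w) (hvw : W (v ≫ w)) : Nonempty (Filler W f v) := by
  obtain ⟨Q⟩ := hW.filler (f ≫ w) (v ≫ w) hvw
  obtain ⟨e, r, β, hr, -⟩ := hW.exists_iso_lift hw
    (α_ Q.fst f w ≪≫ Q.iso ≪≫ (α_ Q.snd v w).symm)
  exact ⟨⟨e, r ≫ Q.fst, r ≫ Q.snd, hW.comp_mem _ _ hr Q.mem,
    α_ _ _ _ ≪≫ β ≪≫ (α_ _ _ _).symm⟩⟩

section

variable {s t x y c : B} {l : s ⟶ x} {r : s ⟶ y} {l' : t ⟶ x} {r' : t ⟶ y} {p : x ⟶ c}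
  {q : y ⟶ c}

/- The 2-morphism on the right legs is a lift along `q` of `κ' · Q.iso · κ⁻¹`. -/
theorem exists_matches (hW : IsBicalculus W) (hq : W q) (Q : Filler W l l') (κ : l ≫ p ≅ r ≫ q)
    (κ' : l' ≫ p ≅ r' ≫ q) :
    ∃ P : CommonRefinement l r l' r', W P.fst ∧ P.Matches κ.hom κ'.hom := by
  obtain ⟨τ, hτ⟩ : ∃ τ : (Q.fst ≫ r) ≫ q ≅ (Q.snd ≫ r') ≫ q,
      Q.iso.inv ▷ p ≫ restrictCell Q.fst κ.hom ≫ τ.hom = restrictCell Q.snd κ'.hom := by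
    refine ⟨(restrictIso Q.fst κ).symm ≪≫ whiskerRightIso Q.iso p ≪≫ restrictIso Q.snd κ', ?_⟩
    rw [← restrictIso_hom Q.fst κ, ← restrictIso_hom Q.snd κ']
    simp only [Iso.trans_hom, Iso.symm_hom, whiskerRightIso_hom, Iso.hom_inv_id_assoc,
      inv_hom_whiskerRight_assoc]
  obtain ⟨e, k, β, hk, hβ⟩ := hW.exists_iso_lift hq τ
  refine ⟨⟨e, k ≫ Q.fst, k ≫ Q.snd, restrictIso k Q.iso.symm,
    α_ _ _ _ ≪≫ β ≪≫ (α_ _ _ _).symm⟩, hW.comp_mem _ _ hk Q.mem, ?_⟩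
  rw [CommonRefinement.Matches, restrictCell_comp, ← hτ]
  simp only [CommonRefinement.transport, Iso.trans_hom, Iso.symm_hom, comp_whiskerRight, hβ,
    restrictIso_hom, restrictCell]
  bicategory

theorem exists_matches_restrict_of_paste_eq (hW : IsBicalculus W)
    {P : CommonRefinement l r l' r'} {κ : l ≫ p ⟶ r ≫ q} {κ' : l' ≫ p ⟶ r' ≫ q}
    (h : P.Matches κ κ') {b d : B} {f : c ⟶ d} {m : b ⟶ d} (hm : W m) {p₁ : x ⟶ b} {q₁ : y ⟶ b}
    {φ : p₁ ≫ m ⟶ p ≫ f} {ψ : q ≫ f ⟶ q₁ ≫ m} {μ : l ≫ p₁ ⟶ r ≫ q₁} {μ' : l' ≫ p₁ ⟶ r' ≫ q₁}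
    (hμ : paste (𝟙 (p₁ ≫ m)) (𝟙 (q₁ ≫ m)) μ = paste φ ψ κ)
    (hμ' : paste (𝟙 (p₁ ≫ m)) (𝟙 (q₁ ≫ m)) μ' = paste φ ψ κ') :
    ∃ (e : B) (k : e ⟶ P.obj), W k ∧ (P.restrict k).Matches μ μ' := by
  have hpaste : paste (𝟙 (p₁ ≫ m)) (𝟙 (q₁ ≫ m)) (P.transport μ) =
      paste (𝟙 (p₁ ≫ m)) (𝟙 (q₁ ≫ m)) (restrictCell P.snd μ') := by
    rw [← P.transport_paste, ← restrictCell_paste, hμ, hμ']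
    exact h.paste φ ψ
  have hwhisker : P.transport μ ▷ m = restrictCell P.snd μ' ▷ m := by
    simpa only [paste, whiskerLeft_id, Category.id_comp, Category.comp_id, cancel_epi,
      cancel_mono] using hpaste
  obtain ⟨e, k, hk, hk'⟩ := hW.exists_whiskerLeft_eq hm hwhisker
  exact ⟨e, k, hk, P.matches_restrict k hk'⟩

end

end IsBicalculus

namespace Squares.AssociatorData

variable {B : Type u} [Bicategory.{w, v} B] {W : MorphismProperty B} {a b c d : B}
  {F : Fraction W a b} {G : Fraction W b c} {H : Fraction W c d} {S : Squares F G H}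

theorem paste_ω_eq (X : S.AssociatorData) :
    paste (𝟙 ((S.σ.fst ≫ S.δ.snd) ≫ G.den)) (𝟙 ((S.η.snd ≫ S.ξ.fst) ≫ G.den)) X.ω.hom =
      paste ((α_ _ _ _).hom ≫ S.σ.fst ◁ S.δ.iso.inv ≫ (α_ _ _ _).inv)
        (S.η.iso.hom ≫ (α_ _ _ _).inv) X.γ.hom := by
  simp only [paste, X.ω_comm, omegaPasting]
  bicategory

theorem paste_ρ_eq (X : S.AssociatorData) :
    paste (𝟙 (S.σ.snd ≫ H.den)) (𝟙 ((S.η.snd ≫ S.ξ.snd) ≫ H.den)) X.ρ.hom =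
      paste (S.σ.iso.inv ≫ (α_ _ _ _).inv)
        ((α_ _ _ _).hom ≫ S.η.snd ◁ S.ξ.iso.hom ≫ (α_ _ _ _).inv) X.ω.hom := by
  simp only [paste, X.ρ_comm, rhoPasting]
  bicategory

theorem diagram_α_hom (hW : IsBicalculus W) (X : S.AssociatorData) :
    (X.diagram hW).α.hom =
      paste (α_ S.σ.fst S.δ.fst F.den).inv (𝟙 (S.η.fst ≫ F.den)) X.γ.hom := by
  simp only [diagram, paste, bicategoricalIsoComp, Iso.trans_hom, whiskerRightIso_hom,
    Iso.refl_hom]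
  bicategory

theorem diagram_β (hW : IsBicalculus W) (X : S.AssociatorData) :
    (X.diagram hW).β =
      paste (𝟙 (S.σ.snd ≫ H.num)) (α_ S.η.snd S.ξ.snd H.num).hom X.ρ.hom := by
  simp only [diagram, paste]
  bicategory

theorem diagram_equivalent (hW : IsBicalculus W) (X X' : S.AssociatorData) :
    (X.diagram hW).Equivalent (X'.diagram hW) := by
  obtain ⟨Q⟩ := hW.nonempty_filler_of_comp_mem X.u₄
    (hW.comp_mem _ _ S.σ.mem (hW.comp_mem _ _ S.δ.mem F.mem)) X'.mem
  obtain ⟨P, hP, hγ⟩ := hW.exists_matches S.η.mem Q X.γ X'.γ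
  obtain ⟨e, k, hk, hω⟩ :=
    hW.exists_matches_restrict_of_paste_eq hγ G.mem X.paste_ω_eq X'.paste_ω_eq
  obtain ⟨e', k', hk', hρ⟩ :=
    hW.exists_matches_restrict_of_paste_eq hω H.mem X.paste_ρ_eq X'.paste_ρ_eq
  refine Diagram.equivalent_of_matches ((P.restrict k).restrict k')
    (hW.comp_mem _ _ (hW.comp_mem _ _ hk' (hW.comp_mem _ _ hk hP)) X.mem) ?_ ?_
  · rw [diagram_α_hom, diagram_α_hom]
    exact ((hγ.restrict k).restrict k').paste _ _
  · rw [diagram_β, diagram_β]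
    exact hρ.paste _ _

end Squares.AssociatorData

end BicatFractions

open BicatFractions in
theorem mainTheorem4_general {B : Type u} [Bicategory.{w, v} B] {W : MorphismProperty B}
    (hW : IsBicalculus W) {a b c d : B} {F : Fraction W a b} {G : Fraction W b c}
    {H : Fraction W c d} (S : Squares F G H) :
    (∀ (C : ChoiceC W) (D : ChoiceD W) (X : S.AssociatorData),
      (X.diagram hW).toTwoMorphism = S.associator hW C D) ∧
    (∀ X X' : S.AssociatorData, (X.diagram hW).Equivalent (X'.diagram hW)) ∧
    (∀ (C C' : ChoiceC W) (D D' : ChoiceD W), S.associator hW C D = S.associator hW C' D') :=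
  ⟨fun _ _ X => Quot.sound (X.diagram_equivalent hW _), fun X => X.diagram_equivalent hW,
    fun _ _ _ _ => Quot.sound (Squares.AssociatorData.diagram_equivalent hW _ _)⟩

open BicatFractions in
theorem mainTheorem4 {B : Type u} [Bicategory.{w, v} B] (W : MorphismProperty B)
    (hW : IsBicalculus W) (C : ChoiceC W) {a b c d : B}
    (F : Fraction W a b) (G : Fraction W b c) (H : Fraction W c d) :
    (∀ (D : ChoiceD W) (X : (Squares.ofChoice hW C F G H).AssociatorData),
      (X.diagram hW).toTwoMorphism = associator hW C D F G H) ∧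
    (∀ X X' : (Squares.ofChoice hW C F G H).AssociatorData,
      (X.diagram hW).Equivalent (X'.diagram hW)) ∧
    (∀ D D' : ChoiceD W, associator hW C D F G H = associator hW C D' F G H) ∧
    (∀ (D : ChoiceD W) (C' : ChoiceC W) (D' : ChoiceD W),
      (Squares.ofChoice hW C F G H).associator hW C' D' = associator hW C D F G H) :=
  have ⟨represents, equivalent, independent⟩ :=
    mainTheorem4_general hW (Squares.ofChoice hW C F G H)
  ⟨represents C, equivalent, independent C C, fun D C' D' => independent C' C D' D⟩
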